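/- Let $p$ be a prime, $n\ge 1$, and let $d\ge 1$ be an integer. Let $\mathrm{Tr}\colon\mathbb F_{p^n}\to\mathbb F_p$ be the absolute trace and $\zeta_p=e^{2\pi i/p}$. For $F\colon\mathbb F_{p^n}\to\mathbb F_{p^n}$ and $a,b\in\mathbb F_{p^n}$ put $$W_F(b,a)=\sum_{x\in\mathbb F_{p^n}}\zeta_p^{\mathrm{Tr}(bF(x))-\mathrm{Tr}(ax)}.$$ The map $F$ is called plateaued if for every $b\in\mathbb F_{p^n}$ there is an integer $s_b\ge 0$ such that $|W_F(b,a)|\in\{0,p^{(n+s_b)/2}\}$ for all $a\in\mathbb F_{p^n}$. For $k\ge 2$, the map $F$ is called $k$-to-$1$ if $k\mid p^n-1$, exactly one of its preimage sets has size $1$, and all its other nonempty preimage sets have size exactly $k$. Suppose that $F(x)=x^d$ is a plateaued map on $\mathbb F_{p^n}$. Then: 1. If $n$ is odd, then $\gcd(d,p^n-1)\in\{1,2\}$. 2. If $n$ is even, then $\gcd(d,p^n-1)=1$ or $\gcd(d,p^n-1)=p^t+1$ for some integer $t\ge 0$. 3. If $\gcd(d,p^n-1)=2$, then $p$ is odd.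 4. Consequently, either $\gcd(d,p^n-1)=1$ and $F$ is a permutation of $\mathbb F_{p^n}$, or there is an integer $t\ge 0$ such that $\gcd(d,p^n-1)=p^t+1$ and $F$ is $(p^t+1)$-to-$1$. -/

import Mathlib

open scoped BigOperators

/-- The Walsh transform `W_f(a) = ∑ x, ζ_p ^ (f x - Tr (a x))` of a `p`-ary function `f` on a finite
field `K` of characteristic `p`, with the scalar product `⟨a, x⟩ = Tr (a x)` given by the absolute
trace. Here `ZMod.stdAddChar j = exp (2 π i j / p) = ζ_p ^ j`. -/
noncomputable def walsh (p : ℕ) [Fact p.Prime] {K : Type*} [Field K] [Fintype K]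
    [Algebra (ZMod p) K] (f : K → ZMod p) (a : K) : ℂ :=
  ∑ x : K, ZMod.stdAddChar (f x - Algebra.trace (ZMod p) K (a * x))

/-- `f` is `t`-plateaued: `|W_f(a)| ∈ {0, p ^ ((n + t) / 2)}` for all `a`, where `n = [K : 𝔽_p]`. -/
def IsTPlateaued (p : ℕ) [Fact p.Prime] {K : Type*} [Field K] [Fintype K]
    [Algebra (ZMod p) K] (t : ℕ) (f : K → ZMod p) : Prop :=
  ∀ a : K, ‖walsh p f a‖ = 0 ∨
    ‖walsh p f a‖ = (p : ℝ) ^ (((Module.finrank (ZMod p) K : ℝ) + (t : ℝ)) / 2)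

/-- The component function `F_b(x) = ⟨b, F x⟩ = Tr (b F(x))`. -/
noncomputable def componentFn (p : ℕ) [Fact p.Prime] {K : Type*} [Field K] [Fintype K]
    [Algebra (ZMod p) K] (F : K → K) (b : K) : K → ZMod p :=
  fun x => Algebra.trace (ZMod p) K (b * F x)

/-- `F` is plateaued: every component function `F_b` is `s_b`-plateaued for some `s_b`, which may
depend on `b`. -/
def IsPlateaued (p : ℕ) [Fact p.Prime] {K : Type*} [Field K] [Fintype K]
    [Algebra (ZMod p) K] (F : K → K) : Prop :=
  ∀ b : K, ∃ s : ℕ, IsTPlateaued p s (componentFn p F b)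

/-- `F` is a `k`-to-`1` function: `k ∣ |K| - 1`, exactly one preimage set has size `1`, and all
other nonempty preimage sets have size exactly `k`. -/
def IsKToOne {K : Type*} [Fintype K] (k : ℕ) (F : K → K) : Prop :=
  k ∣ Fintype.card K - 1 ∧
    ∃ β₀ : K, (F ⁻¹' {β₀}).ncard = 1 ∧
      ∀ β : K, β ≠ β₀ → (F ⁻¹' {β}).Nonempty →
        (F ⁻¹' {β}).ncard ≠ 1 ∧ (F ⁻¹' {β}).ncard = k

/-! Only e = gcd(d, q - 1) ≥ 3 with q = p^n is hard, since 2 = p^0 + 1. Nonzero fibres of x ↦ x^d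
have e elements, so each Walsh value W_b at 0 is ≡ 1 mod e in ℤ[ζ_p]; hence it is nonzero and |W_b|²
= p^(n + s_b). As p is totally ramified, W_b and a Galois conjugate of it divide one another in some
order. The quotient is a unit u ≡ 1 mod e of absolute value 1 at every embedding, and |u - 1| ≤ 2 <
e forces u = 1. So W_b is a rational integer (`exists_int_eq_of_congr_one`).

Orthogonality gives the first two moments of W_b over b ≠ 0: the sum is 0 and the mean square is q(e
- 1). The mean square forces some s_b = 0, so q is a square. Dividing by that W_b leaves integers 1
+ e k_j, whose moments give ∑ (k_j² + k_j) = 0. Hence every k_j is 0 or -1, and -1 occurs, so (e -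
1)² is a power of p (`even_and_exists_eq_pow_add_one`). -/

open NumberField ComplexConjugate

/-! ### Rigidity of algebraic integers in ℚ(ζ_p) -/

/-- An algebraic integer all of whose conjugates lie in the open unit disc vanishes. -/
lemma RingOfIntegers.eq_zero_of_norm_lt_one {L : Type*} [Field L] [NumberField L] (y : 𝓞 L)
    (h : ∀ φ : L →+* ℂ, ‖φ y‖ < 1) : y = 0 := by
  by_contra hy
  have h1 : (Algebra.norm ℤ y) ≠ 0 := by
    rwa [Ne, Algebra.norm_eq_zero_iff]
  have h2 : ‖algebraMap ℚ ℂ (Algebra.norm ℚ (y : L))‖ < 1 := by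
    rw [Algebra.norm_eq_prod_embeddings ℚ ℂ, norm_prod]
    have hne : (Finset.univ : Finset (L →ₐ[ℚ] ℂ)).Nonempty :=
      @Finset.univ_nonempty _ _ ⟨(Classical.arbitrary (L →+* ℂ)).toRatAlgHom⟩
    refine lt_of_lt_of_eq (Finset.prod_lt_prod_of_nonempty (g := fun _ => (1 : ℝ)) ?_ ?_ hne) (by simp)
    · intro σ _
      rw [norm_pos_iff]
      simpa using hy
    · intro σ _
      exact h σ.toRingHom
  rw [← Algebra.coe_norm_int] at h2
  simp only [eq_ratCast, Rat.cast_intCast, Complex.norm_intCast] at h2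
  have h3 : |Algebra.norm ℤ y| < 1 := by exact_mod_cast h2
  exact h1 (Int.abs_lt_one_iff.mp h3)

/-- Two algebraic integers congruent to `1` modulo `e ≥ 3`, with the same absolute values at all
complex embeddings and one dividing the other, coincide. -/
lemma RingOfIntegers.eq_of_dvd_of_congr_one {L : Type*} [Field L] [NumberField L] {e : ℕ}
    (he : 3 ≤ e) {w₁ w₂ z₁ z₂ : 𝓞 L} (h1 : w₁ = 1 + e * z₁) (h2 : w₂ = 1 + e * z₂) (h0 : w₁ ≠ 0)
    (hdvd : w₁ ∣ w₂) (hn : ∀ φ : L →+* ℂ, ‖φ w₁‖ = ‖φ w₂‖) : w₁ = w₂ := by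
  obtain ⟨u, rfl⟩ := hdvd
  have hu : u = 1 + e * (z₂ - z₁ * u) := by linear_combination h2 - u * h1
  have hy : z₂ - z₁ * u = 0 := by
    refine eq_zero_of_norm_lt_one _ fun φ => ?_
    have hw : ‖φ w₁‖ ≠ 0 := by simpa using h0
    have hφu : ‖φ u‖ = 1 := by
      have := hn φ
      simp only [map_mul, norm_mul] at this
      exact mul_left_cancel₀ hw (by rw [← this, mul_one])
    set y : 𝓞 L := z₂ - z₁ * u
    have h3 : φ u - 1 = e * φ y := by
      rw [hu]; simp
    -- This bound is where e ≥ 3 enters: it makes every conjugate of y smaller than 1.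
    have h4 : (e : ℝ) * ‖φ y‖ ≤ 2 := by
      calc (e : ℝ) * ‖φ y‖ = ‖φ u - 1‖ := by rw [h3]; simp
        _ ≤ ‖φ u‖ + ‖(1 : ℂ)‖ := norm_sub_le _ _
        _ = 2 := by rw [hφu]; norm_num
    have h5 : (3 : ℝ) ≤ e := by exact_mod_cast he
    nlinarith [norm_nonneg (φ y)]
  rw [hu, hy]; simp

/-- In the ring of integers of `ℚ(ζ_p)`, the divisors of `p ^ N` form a chain. -/
lemma dvd_or_dvd_of_dvd_prime_pow (p : ℕ) [hp : Fact p.Prime] {L : Type*} [Field L] [NumberField L]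
    [IsCyclotomicExtension {p} ℚ L] {N : ℕ} {a b : 𝓞 L} (ha : a ∣ (p : 𝓞 L) ^ N)
    (hb : b ∣ (p : 𝓞 L) ^ N) : a ∣ b ∨ b ∣ a := by
  have hζ := IsCyclotomicExtension.zeta_spec p ℚ L
  have hπ := hζ.zeta_sub_one_prime'
  have hA := (IsCyclotomicExtension.Rat.associated_zeta_sub_one_pow_prime p hζ).pow_pow (n := N)
  -- Total ramification: p is associated to a power of the prime ζ - 1.
  rw [← pow_mul] at hA
  rw [← hA.dvd_iff_dvd_right, dvd_prime_pow hπ] at ha hb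
  obtain ⟨i, -, hi⟩ := ha
  obtain ⟨j, -, hj⟩ := hb
  rcases le_total i j with h | h
  · left
    rw [hi.dvd_iff_dvd_left, hj.dvd_iff_dvd_right]
    exact pow_dvd_pow _ h
  · right
    rw [hj.dvd_iff_dvd_left, hi.dvd_iff_dvd_right]
    exact pow_dvd_pow _ h

/-- A rational algebraic integer is an integer. -/
lemma RingOfIntegers.exists_int_eq_of_rat {L : Type*} [Field L] [NumberField L] {x : 𝓞 L} {r : ℚ}
    (hr : algebraMap ℚ L r = x) : ∃ m : ℤ, x = m := by
  have hint : IsIntegral ℤ r := by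
    rw [← isIntegral_algebraMap_iff (algebraMap ℚ L).injective, hr]
    exact x.isIntegral_coe
  obtain ⟨m, hm⟩ := IsIntegrallyClosed.isIntegral_iff.mp hint
  refine ⟨m, RingOfIntegers.ext ?_⟩
  rw [← hr, ← hm]
  simp

/-- Divisibility of integers can be tested in a ring of integers. -/
lemma RingOfIntegers.natCast_dvd_int {L : Type*} [Field L] [NumberField L] {e : ℕ} (he : e ≠ 0)
    {m : ℤ} {z : 𝓞 L} (h : (m : 𝓞 L) = e * z) : (e : ℤ) ∣ m := by
  have he' : (e : L) ≠ 0 := by exact_mod_cast he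
  have hL : (m : L) = e * (z : L) := by simpa using congrArg (algebraMap (𝓞 L) L) h
  obtain ⟨k, rfl⟩ := exists_int_eq_of_rat (x := z) (r := (m : ℚ) / e) (by
    rw [map_div₀, map_intCast, map_natCast, hL, mul_div_cancel_left₀ _ he'])
  exact ⟨k, by exact_mod_cast h⟩

/-- An integer of `ℚ(ζ_p)` congruent to `1` modulo `e ≥ 3`, whose absolute value at every complex
embedding is the square root of `p ^ N`, is rational. -/
lemma exists_int_eq_of_congr_one (p : ℕ) [hp : Fact p.Prime] {L : Type*} [Field L] [NumberField L]
    [IsCyclotomicExtension {p} ℚ L] {e N : ℕ} (he : 3 ≤ e) {w w' z : 𝓞 L} (hw : w = 1 + e * z)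
    (hN : w * w' = (p : 𝓞 L) ^ N) (hconj : ∀ φ : L →+* ℂ, φ w' = conj (φ w)) :
    ∃ m : ℤ, w = m := by
  have hnorm (φ : L →+* ℂ) : ‖φ w‖ ^ 2 = (p : ℝ) ^ N := by
    have h1 := congrArg (fun x : 𝓞 L => φ x) hN
    simp only [map_mul, map_pow, map_natCast, hconj] at h1
    rw [Complex.mul_conj, Complex.normSq_eq_norm_sq] at h1
    exact_mod_cast h1
  have hp0 : ((p : 𝓞 L)) ^ N ≠ 0 := pow_ne_zero _ (by exact_mod_cast hp.out.ne_zero)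
  have hfix (σ : Gal(L/ℚ)) : σ (w : L) = w := by
    let τ : 𝓞 L →+* 𝓞 L := RingOfIntegers.mapRingHom (σ : L →+* L)
    have hτ (x : 𝓞 L) : ((τ x : 𝓞 L) : L) = σ x := rfl
    have h2 : τ w = 1 + e * τ z := by rw [hw]; simp
    have hN2 : τ w * τ w' = (p : 𝓞 L) ^ N := by rw [← map_mul, hN]; simp
    have hn (φ : L →+* ℂ) : ‖φ w‖ = ‖φ (τ w)‖ := by
      have h3 := hnorm (φ.comp (σ : L →+* L))
      rw [← hnorm φ] at h3
      exact ((sq_eq_sq₀ (norm_nonneg _) (norm_nonneg _)).mp h3).symm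
    rw [← hτ]
    congr 1
    rcases dvd_or_dvd_of_dvd_prime_pow p (Dvd.intro _ hN) (Dvd.intro _ hN2) with h | h
    · exact (RingOfIntegers.eq_of_dvd_of_congr_one he hw h2 (left_ne_zero_of_mul (hN ▸ hp0)) h
        hn).symm
    · exact RingOfIntegers.eq_of_dvd_of_congr_one he h2 hw (left_ne_zero_of_mul (hN2 ▸ hp0)) h
        fun φ => (hn φ).symm
  have : IsGalois ℚ L := IsCyclotomicExtension.isGalois {p} ℚ L
  obtain ⟨r, hr⟩ := (IsGalois.mem_range_algebraMap_iff_fixed (F := ℚ) (w : L)).mpr hfix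
  exact RingOfIntegers.exists_int_eq_of_rat hr

/-! ### Fibres of the power map -/

/-- In a finite field, a nonzero `d`-th power has exactly `gcd(d, q - 1)` roots of order `d`. -/
lemma card_filter_pow_eq_pow {K : Type*} [Field K] [Fintype K] [DecidableEq K] {d : ℕ} (hd : 0 < d)
    {x : K} (hx : x ≠ 0) :
    (Finset.univ.filter fun y : K => y ^ d = x ^ d).card = d.gcd (Fintype.card K - 1) := by
  have h := IsCyclic.card_powMonoidHom_ker (G := Kˣ) d
  rw [Nat.card_units, Nat.card_eq_fintype_card (α := K), Nat.gcd_comm] at h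
  rw [← h, ← Fintype.card_subtype, ← Nat.card_eq_fintype_card]
  symm
  refine Nat.card_eq_of_bijective
    (fun u : (powMonoidHom d : Kˣ →* Kˣ).ker => ⟨(u : Kˣ) * x, ?_⟩) ⟨?_, ?_⟩
  · have := u.2
    rw [MonoidHom.mem_ker, powMonoidHom_apply] at this
    rw [mul_pow, ← Units.val_pow_eq_pow_val, this, Units.val_one, one_mul]
  · intro u v huv
    simp only [Subtype.mk.injEq] at huv
    exact Subtype.ext (Units.ext (mul_right_cancel₀ hx huv))
  · rintro ⟨y, hy⟩
    have hy0 : y ≠ 0 := by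
      rintro rfl
      rw [zero_pow hd.ne'] at hy
      exact pow_ne_zero d hx hy.symm
    refine ⟨⟨Units.mk0 y hy0 / Units.mk0 x hx, ?_⟩, ?_⟩
    · rw [MonoidHom.mem_ker, powMonoidHom_apply, div_pow, div_eq_one]
      ext
      simpa using hy
    · simp [hx]

/-- A sum over `d`-th powers of a finite field is the value at `0` plus a multiple of
`gcd(d, q - 1)`. -/
lemma exists_sum_comp_pow_eq {K : Type*} [Field K] [Fintype K] {d : ℕ} (hd : 0 < d)
    {R : Type*} [CommRing R] (f : K → R) :
    ∃ z : R, ∑ x : K, f (x ^ d) = f 0 + (d.gcd (Fintype.card K - 1) : ℕ) * z := by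
  classical
  refine ⟨∑ y ∈ (Finset.univ.erase (0 : K)).image (· ^ d), f y, ?_⟩
  rw [← Finset.add_sum_erase _ _ (Finset.mem_univ (0 : K)), zero_pow hd.ne',
    Finset.sum_comp f (fun x : K => x ^ d), Finset.mul_sum]
  congr 1
  refine Finset.sum_congr rfl fun y hy => ?_
  obtain ⟨x, hx, rfl⟩ := Finset.mem_image.mp hy
  have hx0 : x ≠ 0 := by simpa using hx
  rw [nsmul_eq_mul, ← card_filter_pow_eq_pow hd hx0]
  congr 3
  ext y
  simp only [Finset.mem_filter, Finset.mem_erase, Finset.mem_univ, and_true, true_and,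
    and_iff_right_iff_imp]
  rintro hy rfl
  rw [zero_pow hd.ne'] at hy
  exact pow_ne_zero d hx0 hy.symm

/-! ### Rationality of the Walsh values at 0 -/

lemma walsh_componentFn_zero (p : ℕ) [Fact p.Prime] {K : Type*} [Field K] [Fintype K]
    [Algebra (ZMod p) K] (F : K → K) (b : K) :
    walsh p (componentFn p F b) 0 =
      ∑ x : K, ZMod.stdAddChar (Algebra.trace (ZMod p) K (b * F x)) := by
  simp [walsh, componentFn]

lemma isCyclotomicExtension_cyclotomicField (p : ℕ) [hp : Fact p.Prime] :
    IsCyclotomicExtension {p} ℚ (CyclotomicField p ℚ) := by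
  have : NeZero ((p : ℕ) : ℚ) := ⟨by exact_mod_cast hp.out.ne_zero⟩
  convert CyclotomicField.isCyclotomicExtension p ℚ
  · rfl
  · exact Subsingleton.elim _ _

/-- The field `ℚ(ζ_p)` carries an additive character of `ℤ/p` with values in its ring of integers
that becomes the standard one under a suitable complex embedding. -/
lemma exists_addChar_cyclotomicField (p : ℕ) [hp : Fact p.Prime] :
    ∃ (χ : AddChar (ZMod p) (𝓞 (CyclotomicField p ℚ))) (ι : CyclotomicField p ℚ →+* ℂ),
      ∀ t, ι (χ t) = ZMod.stdAddChar t := by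
  have := isCyclotomicExtension_cyclotomicField p
  let ι : CyclotomicField p ℚ →+* ℂ := Classical.arbitrary _
  have hζ := IsCyclotomicExtension.zeta_spec p ℚ (CyclotomicField p ℚ)
  have hι := hζ.map_of_injective ι.injective
  have hstd : (ZMod.stdAddChar (1 : ZMod p)) ^ p = 1 := by
    rw [← AddChar.map_nsmul_eq_pow]; simp
  -- The embedding is arbitrary, so it need not send ζ to exp(2πi/p); the exponent k corrects for
  -- this.
  obtain ⟨k, -, hk⟩ := hι.eq_pow_of_pow_eq_one hstd
  have hp1 : (hζ.toInteger ^ k) ^ p = 1 := by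
    rw [← pow_mul, mul_comm, pow_mul, hζ.toInteger_isPrimitiveRoot.pow_eq_one, one_pow]
  refine ⟨AddChar.zmodChar p hp1, ι, fun t => ?_⟩
  have ht : t = t.val • (1 : ZMod p) := by simp
  conv_rhs => rw [ht, AddChar.map_nsmul_eq_pow, ← hk]
  rw [AddChar.zmodChar_apply]
  simp only [map_pow]
  rfl

/-- If `gcd(d, q - 1) ≥ 3` and `x ↦ x ^ d` is plateaued, its Walsh values at `0` are rational
integers. -/
lemma IsPlateaued.exists_int_walsh (p : ℕ) [hp : Fact p.Prime] {K : Type*} [Field K] [Fintype K]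
    [Algebra (ZMod p) K] {d : ℕ} (hd : 0 < d) (hF : IsPlateaued p (fun x : K => x ^ d))
    (he : 3 ≤ d.gcd (Fintype.card K - 1)) (b : K) :
    ∃ (m : ℤ) (s : ℕ), walsh p (componentFn p (fun x : K => x ^ d) b) 0 = m ∧
      m ^ 2 = p ^ (Module.finrank (ZMod p) K + s) ∧
      ((d.gcd (Fintype.card K - 1) : ℕ) : ℤ) ∣ m - 1 := by
  obtain ⟨s, hs⟩ := hF b
  set e := d.gcd (Fintype.card K - 1)
  obtain ⟨χ, ι, hχ⟩ := exists_addChar_cyclotomicField p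
  set w : 𝓞 (CyclotomicField p ℚ) := ∑ x : K, χ (Algebra.trace (ZMod p) K (b * x ^ d)) with hw
  set w' : 𝓞 (CyclotomicField p ℚ) := ∑ x : K, χ (-Algebra.trace (ZMod p) K (b * x ^ d)) with hw'
  have hιw : ι w = walsh p (componentFn p (fun x : K => x ^ d) b) 0 := by
    rw [walsh_componentFn_zero, hw]
    simp [hχ]
  have hconj (φ : CyclotomicField p ℚ →+* ℂ) : φ w' = conj (φ w) := by
    let ψ : AddChar (ZMod p) ℂ :=
      ((φ.comp (algebraMap (𝓞 (CyclotomicField p ℚ)) _)) : _ →* ℂ).compAddChar χ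
    have hψ (t) : φ (χ t) = ψ t := rfl
    simp [hw, hw', hψ, AddChar.map_neg_eq_conj]
  obtain ⟨z, hz⟩ := exists_sum_comp_pow_eq hd
    (fun x : K => χ (Algebra.trace (ZMod p) K (b * x)))
  simp only [mul_zero, map_zero, AddChar.map_zero_eq_one] at hz
  change w = 1 + (e : 𝓞 (CyclotomicField p ℚ)) * z at hz
  have he1 : (3 : ℝ) ≤ e := by exact_mod_cast he
  -- If w = 0 then e z = -1, so all conjugates of z have absolute value 1/e < 1.
  have hw0 : w ≠ 0 := by
    intro h
    rw [h] at hz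
    have hz0 : z = 0 := by
      refine RingOfIntegers.eq_zero_of_norm_lt_one z fun φ => ?_
      have h1 : (e : ℂ) * φ z = -1 := by
        have := congrArg (fun x : 𝓞 (CyclotomicField p ℚ) => φ x) hz
        simp at this
        linear_combination -this
      have h2 := congrArg norm h1
      simp only [norm_mul, Complex.norm_natCast, norm_neg, norm_one] at h2
      nlinarith [norm_nonneg (φ z)]
    rw [hz0] at hz
    simp at hz
  have hnorm : ‖ι w‖ ^ 2 = (p : ℝ) ^ (Module.finrank (ZMod p) K + s) := by
    rcases hs 0 with h | h
    · rw [← hιw] at h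
      simp [hw0] at h
    · rw [hιw, h, ← Real.rpow_natCast, ← Real.rpow_mul (by positivity), ← Real.rpow_natCast]
      congr 1
      push_cast
      ring
  have hN : w * w' = (p : 𝓞 (CyclotomicField p ℚ)) ^ (Module.finrank (ZMod p) K + s) := by
    apply RingOfIntegers.ext
    apply ι.injective
    simp only [map_mul, hconj, map_pow, map_natCast]
    rw [Complex.mul_conj, Complex.normSq_eq_norm_sq, hnorm]
    push_cast
    rfl
  have := isCyclotomicExtension_cyclotomicField p
  obtain ⟨m, hm⟩ := exists_int_eq_of_congr_one p he hz hN hconj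
  have hιm : ι w = m := by rw [hm]; simp
  refine ⟨m, s, by rw [← hιw, hιm], ?_, ?_⟩
  · rw [hιm, Complex.norm_intCast, sq_abs] at hnorm
    exact_mod_cast hnorm
  · refine RingOfIntegers.natCast_dvd_int (L := CyclotomicField p ℚ) (z := z) (by omega) ?_
    rw [Int.cast_sub, ← hm, hz]
    simp

/-! ### Moments of the Walsh values -/

/-- The additive character `x ↦ ζ_p ^ Tr x` of a finite field is primitive. -/
lemma isPrimitive_stdAddChar_trace (p : ℕ) [Fact p.Prime] (K : Type*) [Field K] [Fintype K]
    [Algebra (ZMod p) K] :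
    ((ZMod.stdAddChar (N := p)).compAddMonoidHom
      (Algebra.trace (ZMod p) K).toAddMonoidHom).IsPrimitive := by
  refine AddChar.IsPrimitive.of_ne_one (AddChar.ne_one_iff.2 ?_)
  obtain ⟨a, ha⟩ := Algebra.trace_surjective (ZMod p) K 1
  refine ⟨a, fun h => one_ne_zero (α := ZMod p) (ZMod.injective_stdAddChar ?_)⟩
  rw [AddChar.map_zero_eq_one, ← h, ← ha]
  rfl

/-- Orthogonality relation for the characters `x ↦ ζ_p ^ Tr (b x)`. -/
lemma sum_stdAddChar_trace_mul (p : ℕ) [Fact p.Prime] {K : Type*} [Field K] [Fintype K]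
    [DecidableEq K] [Algebra (ZMod p) K] (y : K) :
    ∑ b : K, ZMod.stdAddChar (Algebra.trace (ZMod p) K (b * y)) =
      if y = 0 then (Fintype.card K : ℂ) else 0 := by
  have h := AddChar.sum_mulShift y (isPrimitive_stdAddChar_trace p K)
  push_cast at h
  exact h

/-- The sum of the Walsh values at `0` of the component functions of `x ↦ x ^ d`. -/
lemma sum_walsh_pow (p : ℕ) [Fact p.Prime] {K : Type*} [Field K] [Fintype K]
    [Algebra (ZMod p) K] {d : ℕ} (hd : 0 < d) :
    ∑ b : K, walsh p (componentFn p (fun x : K => x ^ d) b) 0 = Fintype.card K := by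
  classical
  simp_rw [walsh_componentFn_zero]
  rw [Finset.sum_comm]
  simp_rw [sum_stdAddChar_trace_mul, pow_eq_zero_iff hd.ne']
  simp

/-- The second moment of the Walsh values at `0` of the component functions of `x ↦ x ^ d`. -/
lemma sum_walsh_pow_mul_conj (p : ℕ) [Fact p.Prime] {K : Type*} [Field K] [Fintype K]
    [Algebra (ZMod p) K] {d : ℕ} (hd : 0 < d) :
    ∑ b : K, walsh p (componentFn p (fun x : K => x ^ d) b) 0 *
        conj (walsh p (componentFn p (fun x : K => x ^ d) b) 0) =
      Fintype.card K *
        (1 + (Fintype.card K - 1) * (d.gcd (Fintype.card K - 1) : ℕ)) := by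
  classical
  have h1 (b : K) : walsh p (componentFn p (fun x : K => x ^ d) b) 0 *
      conj (walsh p (componentFn p (fun x : K => x ^ d) b) 0) =
      ∑ x : K, ∑ y : K, ZMod.stdAddChar (Algebra.trace (ZMod p) K (b * (y ^ d - x ^ d))) := by
    rw [walsh_componentFn_zero, map_sum, mul_comm, Finset.sum_mul_sum]
    refine Finset.sum_congr rfl fun x _ => Finset.sum_congr rfl fun y _ => ?_
    rw [← AddChar.map_neg_eq_conj, ← AddChar.map_add_eq_mul, mul_sub, map_sub, sub_eq_neg_add]
  simp_rw [h1]
  rw [Finset.sum_comm]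
  have h2 (x : K) : ∑ b : K, ∑ y : K,
      ZMod.stdAddChar (Algebra.trace (ZMod p) K (b * (y ^ d - x ^ d))) =
      (Fintype.card K : ℂ) * (Finset.univ.filter fun y : K => y ^ d = x ^ d).card := by
    rw [Finset.sum_comm]
    simp_rw [sum_stdAddChar_trace_mul, sub_eq_zero]
    rw [← Finset.sum_filter, Finset.sum_const, nsmul_eq_mul, mul_comm]
  simp_rw [h2]
  rw [← Finset.mul_sum, ← Finset.add_sum_erase _ _ (Finset.mem_univ (0 : K))]
  congr 2
  · simp only [zero_pow hd.ne', pow_eq_zero_iff hd.ne']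
    exact_mod_cast Finset.card_eq_one.mpr ⟨0, by ext; simp⟩
  · rw [Finset.sum_congr rfl fun x hx => by
      rw [card_filter_pow_eq_pow hd (Finset.ne_of_mem_erase hx)]]
    rw [Finset.sum_const, nsmul_eq_mul, Finset.card_erase_of_mem (Finset.mem_univ _),
      Finset.card_univ, Nat.cast_sub Fintype.card_pos, Nat.cast_one]

/-! ### Integer families with prescribed moments -/

lemma Nat.Prime.exists_eq_pow_of_sq_eq_pow {p x s : ℕ} (hp : p.Prime) (h : x ^ 2 = p ^ s) :
    ∃ k, x = p ^ k ∧ s = 2 * k := by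
  obtain ⟨k, -, rfl⟩ := (Nat.dvd_prime_pow hp).mp (h ▸ dvd_pow_self x two_ne_zero)
  refine ⟨k, rfl, ?_⟩
  rw [← pow_mul] at h
  rw [← Nat.pow_right_injective hp.two_le h, mul_comm]

/-- A family of integers congruent to `1` modulo `e ≥ 3`, with squares `p ^ (n + s i)` and the
first two moments of the Walsh values of an `e`-to-`1` map, exists only if `n` is even and
`e - 1` is a power of `p`. -/
lemma even_and_exists_eq_pow_add_one {p : ℕ} (hp : p.Prime) {n e : ℕ} (he : 3 ≤ e)
    (hen : (e : ℤ) ∣ p ^ n - 1) {α : Type*} (S : Finset α) (hS : S.Nonempty) (m : α → ℤ)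
    (s : α → ℕ) (hm : ∀ i, m i ^ 2 = p ^ (n + s i)) (hme : ∀ i, (e : ℤ) ∣ m i - 1)
    (h1 : ∑ i ∈ S, m i = 0) (h2 : ∑ i ∈ S, m i ^ 2 = p ^ n * (S.card * (e - 1))) :
    Even n ∧ ∃ t : ℕ, e = p ^ t + 1 := by
  have hpn : (0 : ℤ) < (p : ℤ) ^ n := pow_pos (by exact_mod_cast hp.pos) n
  have hS0 : (0 : ℤ) < S.card := by exact_mod_cast hS.card_pos
  have he0 : (e : ℤ) ≠ 0 := by omega
  obtain ⟨i, hi⟩ : ∃ i, s i = 0 := by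
    by_contra! hs
    have hlow (i : α) : (p : ℤ) ^ n * (e + 1) ≤ m i ^ 2 := by
      rw [hm, pow_add]
      refine mul_le_mul_of_nonneg_left ?_ hpn.le
      -- Both m i ^ 2 and p ^ n are 1 mod e, hence so is p ^ s i; exceeding 1, it is at least e + 1,
      -- above the mean e - 1.
      have hd : (e : ℤ) ∣ p ^ s i - 1 := by
        have h3 : (e : ℤ) ∣ m i ^ 2 - 1 := by
          have : m i ^ 2 - 1 = (m i - 1) * (m i + 1) := by ring
          exact this ▸ (hme i).mul_right _
        rw [hm] at h3
        have h4 : (p : ℤ) ^ s i - 1 = (p ^ (n + s i) - 1) - (p ^ n - 1) * p ^ s i := by ring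
        exact h4 ▸ h3.sub (hen.mul_right _)
      have hgt : (1 : ℤ) < p ^ s i := by exact_mod_cast Nat.one_lt_pow (hs i) hp.one_lt
      linarith [Int.le_of_dvd (by linarith) hd]
    have h3 := Finset.card_nsmul_le_sum S _ _ fun i _ => hlow i
    rw [h2, nsmul_eq_mul] at h3
    nlinarith [mul_pos hS0 hpn]
  have hu : m i ^ 2 = p ^ n := by rw [hm, hi, add_zero]
  have hu0 : m i ≠ 0 := by
    intro h
    rw [h] at hu
    simp at hu
    omega
  refine ⟨?_, ?_⟩
  · obtain ⟨k, -, hk⟩ := hp.exists_eq_pow_of_sq_eq_pow (x := (m i).natAbs) (s := n) (by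
      zify
      rw [sq_abs, hu])
    exact ⟨k, by omega⟩
  have hdvd (j : α) : m i ∣ m j := by
    rw [← Int.pow_dvd_pow_iff two_ne_zero, hu, hm, pow_add]
    exact Dvd.intro _ rfl
  choose w hw using hdvd
  have hw2 (j : α) : w j ^ 2 = p ^ s j := by
    have := hm j
    rw [hw j, mul_pow, hu, pow_add] at this
    exact mul_left_cancel₀ hpn.ne' this
  have hwe (j : α) : (e : ℤ) ∣ w j - 1 := by
    have h3 : w j - 1 = (m j - 1) - (m i - 1) * w j := by rw [hw j]; ring
    exact h3 ▸ (hme j).sub ((hme i).mul_right _)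
  choose k hk using hwe
  replace hk (j : α) : w j = 1 + e * k j := by linarith [hk j]
  have h3 : (S.card : ℤ) + e * ∑ j ∈ S, k j = 0 := by
    rw [Finset.sum_congr rfl fun j _ => hw j, ← Finset.mul_sum] at h1
    have := (mul_eq_zero.mp h1).resolve_left hu0
    rw [Finset.sum_congr rfl fun j _ => hk j, Finset.sum_add_distrib, ← Finset.mul_sum] at this
    simpa using this
  have h4 : (S.card : ℤ) + 2 * e * ∑ j ∈ S, k j + e ^ 2 * ∑ j ∈ S, k j ^ 2 =
      S.card * (e - 1) := by
    have h5 : ∑ j ∈ S, w j ^ 2 = S.card * (e - 1) := by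
      refine mul_left_cancel₀ hpn.ne' ?_
      rw [← h2, Finset.mul_sum]
      refine Finset.sum_congr rfl fun j _ => ?_
      rw [hw j, mul_pow, hu]
    rw [← h5, Finset.mul_sum, Finset.mul_sum, Finset.card_eq_sum_ones, Nat.cast_sum,
      ← Finset.sum_add_distrib, ← Finset.sum_add_distrib]
    refine Finset.sum_congr rfl fun j _ => ?_
    rw [hk j]
    push_cast
    ring
  have h5 : ∑ j ∈ S, (k j ^ 2 + k j) = 0 := by
    rw [Finset.sum_add_distrib]
    refine mul_left_cancel₀ (pow_ne_zero 2 he0) ?_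
    -- The multiple e - 2 of the first moment cancels `S.card` and leaves e² ∑ (k² + k).
    linear_combination h4 + (e - 2) * h3
  have hnn (x : ℤ) : 0 ≤ x ^ 2 + x := by
    rcases le_or_gt 0 x with h | h <;> nlinarith
  rw [Finset.sum_eq_zero_iff_of_nonneg fun j _ => hnn _] at h5
  obtain ⟨j, hjS, hj⟩ : ∃ j ∈ S, k j ≠ 0 := by
    by_contra! h
    rw [Finset.sum_eq_zero h] at h3
    omega
  have hj1 : k j = -1 := by
    have h6 : k j * (k j + 1) = 0 := by linear_combination h5 j hjS
    have := (mul_eq_zero.mp h6).resolve_left hj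
    omega
  have h7 := hw2 j
  rw [hk, hj1] at h7
  obtain ⟨t, ht, -⟩ := hp.exists_eq_pow_of_sq_eq_pow (x := e - 1) (s := s j) (by
    zify [show 1 ≤ e by omega]
    rw [← h7]
    ring)
  exact ⟨t, by omega⟩

/-! ### Application to plateaued power maps -/

/-- If `x ↦ x ^ d` is plateaued on a field with `p ^ n` elements and `gcd(d, p ^ n - 1) ≥ 3`,
then `n` is even and `gcd(d, p ^ n - 1) - 1` is a power of `p`. -/
lemma IsPlateaued.even_and_gcd_eq (p : ℕ) [hp : Fact p.Prime] (n : ℕ) {K : Type*} [Field K]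
    [Fintype K] [Algebra (ZMod p) K] (hK : Fintype.card K = p ^ n) {d : ℕ} (hd : 0 < d)
    (hF : IsPlateaued p (fun x : K => x ^ d)) (he : 3 ≤ d.gcd (p ^ n - 1)) :
    Even n ∧ ∃ t : ℕ, d.gcd (p ^ n - 1) = p ^ t + 1 := by
  classical
  have hfin : Module.finrank (ZMod p) K = n := by
    have h := Module.card_eq_pow_finrank (K := ZMod p) (V := K)
    rw [ZMod.card, hK] at h
    exact (Nat.pow_right_injective hp.out.two_le h).symm
  have hq1 : 1 ≤ p ^ n := Nat.one_le_pow _ _ hp.out.pos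
  choose m s hW hm hme using hF.exists_int_walsh p hd (by rwa [hK])
  rw [hfin] at hm
  rw [hK] at hme
  have h1 := sum_walsh_pow p (K := K) hd
  have h2 := sum_walsh_pow_mul_conj p (K := K) hd
  simp only [hW, hK, map_intCast] at h1 h2
  have h1 : ∑ b, m b = (p : ℤ) ^ n := by exact_mod_cast h1
  have h2 : ∑ b, m b * m b = (p : ℤ) ^ n * (1 + (p ^ n - 1) * (d.gcd (p ^ n - 1) : ℕ)) := by
    push_cast at h2
    exact_mod_cast h2
  have hm0 : m 0 = (p : ℤ) ^ n := by
    have := hW 0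
    rw [walsh_componentFn_zero] at this
    simp [hK] at this
    exact_mod_cast this.symm
  -- Removing b = 0, whose value is q, makes the first moment vanish.
  rw [← Finset.add_sum_erase _ _ (Finset.mem_univ (0 : K)), hm0] at h1 h2
  have hcard : ((Finset.univ.erase (0 : K)).card : ℤ) = p ^ n - 1 := by
    rw [Finset.card_erase_of_mem (Finset.mem_univ _), Finset.card_univ, hK]
    push_cast [hq1]
    ring
  refine even_and_exists_eq_pow_add_one hp.out he ?_ (Finset.univ.erase (0 : K))
    ⟨1, by simp⟩ m s hm hme (by linarith) ?_
  · have := Int.natCast_dvd_natCast.mpr (Nat.gcd_dvd_right d (p ^ n - 1))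
    rwa [Nat.cast_sub hq1, Nat.cast_pow, Nat.cast_one] at this
  · simp only [pow_two (m _)]
    rw [hcard]
    linear_combination h2

theorem mainTheorem2 (p : ℕ) [Fact p.Prime] (n : ℕ) {K : Type*} [Field K] [Fintype K]
    [Algebra (ZMod p) K] (hK : Fintype.card K = p ^ n)
    (d : ℕ) (hd : 0 < d) (hF : IsPlateaued p (fun x : K => x ^ d)) :
    (Odd n → Nat.gcd d (p ^ n - 1) = 1 ∨ Nat.gcd d (p ^ n - 1) = 2) ∧
    (Even n → Nat.gcd d (p ^ n - 1) = 1 ∨ ∃ t : ℕ, Nat.gcd d (p ^ n - 1) = p ^ t + 1) ∧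
    (Nat.gcd d (p ^ n - 1) = 2 → Odd p) ∧
    ((Nat.gcd d (p ^ n - 1) = 1 ∧ Function.Bijective (fun x : K => x ^ d)) ∨
      ∃ t : ℕ, Nat.gcd d (p ^ n - 1) = p ^ t + 1 ∧
        IsKToOne (p ^ t + 1) (fun x : K => x ^ d)) := by
  classical
  have hp : p.Prime := Fact.out
  have hlarge := hF.even_and_gcd_eq p n hK hd
  have hpos : 0 < d.gcd (p ^ n - 1) := Nat.gcd_pos_of_pos_left _ hd
  have hcases : d.gcd (p ^ n - 1) = 1 ∨ ∃ t : ℕ, d.gcd (p ^ n - 1) = p ^ t + 1 := by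
    rcases Nat.lt_or_ge (d.gcd (p ^ n - 1)) 3 with h | h
    · by_cases h1 : d.gcd (p ^ n - 1) = 1
      · exact Or.inl h1
      -- Here the gcd is 2 = p^0 + 1.
      · exact Or.inr ⟨0, by rw [pow_zero]; omega⟩
    · exact Or.inr (hlarge h).2
  have hn : n ≠ 0 := by
    rintro rfl
    have := Fintype.one_lt_card (α := K)
    simp [hK] at this
  refine ⟨fun hodd => ?_, fun _ => hcases, fun h => ?_, ?_⟩
  · rcases Nat.lt_or_ge (d.gcd (p ^ n - 1)) 3 with h | h
    · omega
    · exact absurd (hlarge h).1 (Nat.not_even_iff_odd.mpr hodd)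
  · by_contra hodd
    have hev : Even (p ^ n) := (Nat.not_odd_iff_even.mp hodd).pow_of_ne_zero hn
    have h2 : 2 ∣ p ^ n - 1 := h ▸ Nat.gcd_dvd_right d (p ^ n - 1)
    have h1 : 1 ≤ p ^ n := Nat.one_le_pow _ _ hp.pos
    obtain ⟨k, hk⟩ := hev
    omega
  · have hzero : (fun x : K => x ^ d) ⁻¹' {0} = {0} := by
      ext x
      simp [hd.ne']
    have hfib {x : K} (hx : x ≠ 0) :
        ((fun y : K => y ^ d) ⁻¹' {x ^ d}).ncard = d.gcd (p ^ n - 1) := by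
      rw [← hK, ← card_filter_pow_eq_pow hd hx, ← Set.ncard_coe_finset]
      congr 1
      ext y
      simp
    rcases hcases with h | ⟨t, ht⟩
    · refine Or.inl ⟨h, Finite.injective_iff_bijective.mp fun x y hxy => ?_⟩
      by_cases hx : x = 0
      · subst hx
        have hy : y ∈ (fun x : K => x ^ d) ⁻¹' {0} := by
          simpa [zero_pow hd.ne'] using hxy.symm
        rw [hzero] at hy
        exact hy.symm
      · have h1 := hfib hx
        rw [h, Set.ncard_eq_one] at h1
        obtain ⟨a, ha⟩ := h1
        have hxa : x ∈ (fun y : K => y ^ d) ⁻¹' {x ^ d} := rfl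
        have hya : y ∈ (fun y : K => y ^ d) ⁻¹' {x ^ d} := hxy.symm
        rw [ha] at hxa hya
        exact hxa.trans hya.symm
    · refine Or.inr ⟨t, ht, ?_, 0, by rw [hzero, Set.ncard_singleton], ?_⟩
      · rw [hK, ← ht]
        exact Nat.gcd_dvd_right _ _
      · rintro _ hβ ⟨x, rfl⟩
        have hx : x ≠ 0 := by
          rintro rfl
          exact hβ (zero_pow hd.ne')
        have hc := hfib hx
        rw [ht] at hc
        have : 0 < p ^ t := pow_pos hp.pos t
        exact ⟨fun h => by have := hc.symm.trans h; omega, hc⟩
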